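/- Let $\omega^\omega$ (Baire space) and $2^\omega$ (Cantor space) carry their product topologies, $\mathcal B$ and $\mathcal C$. A pointclass $\Gamma$ is a collection of sets of reals, i.e. of subsets of $\omega^\omega$ and of $2^\omega$. It is called topologically reasonable if it is closed under preimages by continuous maps (between any two of the spaces $\omega^\omega$, $2^\omega$) and if $A\cap Q\in\Gamma$ whenever $A\in\Gamma$ and $Q$ is a closed subset of the same space. A tree on a set $X$ is a nonempty set $T\subseteq X^{<\omega}$ closed under initial segments; $[T]$ is the set of $f\in X^\omega$ with $f{\restriction}n\in T$ for all $n$. A node of $T$ is splitting if it has more than one immediate successor in $T$, and $\omega$-splitting if it has infinitely many. Let $\mathbb L$ be the set of Laver trees, i.e. trees $T$ on $\omega$ having a node $s$ (the stem) such that every node of $T$ is comparable with $s$ and every node of $T$ extending $s$ (including $s$) is $\omega$-splitting; let $\mathbb M$ be the set of superperfect trees, i.e. trees on $\omega$ in which every splitting node is $\omega$-splitting and every node has an extension that is a splitting node; let $\mathbb S$ be the set of perfect trees, i.e. trees on $2$ in which every node has an extension that is a splitting node. For $\mathbb P\in\{\mathbb L,\mathbb M,\mathbb S\}$, a set $A$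 (with $A\subseteq\omega^\omega$ for $\mathbb L,\mathbb M$ and $A\subseteq 2^\omega$ for $\mathbb S$) is $\mathbb P$-measurable if for every $p\in\mathbb P$ there is $p'\in\mathbb P$ with $p'\subseteq p$ such that $[p']\cap A=\emptyset$ or $[p']\setminus A=\emptyset$. A set $A\subseteq\omega^\omega$ is $\mathbb C$-measurable (Cohen) if it has the Baire property with respect to $\mathcal B$, and $\mathbb D$-measurable (Hechler) if it has the Baire property with respect to the dominating topology, which is generated by the sets $[N,f]=\{x\in\omega^\omega : x{\restriction}N=f{\restriction}N \text{ and } x(n)\ge f(n)\text{ for all }n\}$ for $N\in\omega$, $f\in\omega^\omega$. Write $\Gamma(\mathbb P)$ for the sentence "every set in $\Gamma$ (on the space belonging to $\mathbb P$) is $\mathbb P$-measurable". Corollary. For every topologically reasonable pointclass $\Gamma$: $$\Gamma(\mathbb D)\Rightarrow\Gamma(\mathbb C),\qquad \Gamma(\mathbb D)\Rightarrow\Gamma(\mathbb L),\qquad \Gamma(\mathbb C)\Rightarrow\Gamma(\mathbb M),\qquad \Gamma(\mathbb L)\Rightarrow\Gamma(\mathbb M)\Rightarrow\Gamma(\mathbb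 S).$$ Moreover $\Gamma(\mathbb D)$ also implies the Cantor space form of $\Gamma(\mathbb C)$: every $A\subseteq 2^\omega$ in $\Gamma$ has the Baire property with respect to $\mathcal C$. -/

import Mathlib

open Descriptive

namespace Reals

/-! ### Trees and their branches -/

section Trees

variable {α : Type}

/-- `[T]`: the set of infinite branches `f` of the tree `T`, i.e. `f ↾ n ∈ T` for all `n`. -/
def branches (T : tree α) : Set (ℕ → α) :=
  {f | ∀ n : ℕ, (List.range n).map f ∈ T}

/-- `a` indexes the immediate successor `s ⌢ a` of the node `s` in `T`. -/
def succs (T : tree α) (s : List α) : Set α :=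
  {a | s ++ [a] ∈ T}

/-- A splitting node: a node with more than one immediate successor. -/
def IsSplitting (T : tree α) (s : List α) : Prop :=
  s ∈ T ∧ (succs T s).Nontrivial

/-- An `ω`-splitting node: a node with infinitely many immediate successors. -/
def IsOmegaSplitting (T : tree α) (s : List α) : Prop :=
  s ∈ T ∧ (succs T s).Infinite

end Trees

/-! ### The tree forcings, ordered by inclusion -/

/-- Laver forcing: trees with a stem `s` (a node comparable with all nodes) such that all nodes
from the stem on are `ω`-splitting. -/
def laverForcing : Set (tree ℕ) :=
  {T | ∃ s ∈ T, (∀ t ∈ T, t <+: s ∨ s <+: t) ∧ ∀ t ∈ T, s <+: t → IsOmegaSplitting T t}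

/-- Miller forcing: the nonempty superperfect trees on `ω`. -/
def millerForcing : Set (tree ℕ) :=
  {T | [] ∈ T ∧ (∀ s, IsSplitting T s → IsOmegaSplitting T s) ∧
    ∀ s ∈ T, ∃ t, s <+: t ∧ IsSplitting T t}

/-- Sacks forcing: the nonempty perfect trees on `2`. -/
def sacksForcing : Set (tree Bool) :=
  {T | [] ∈ T ∧ ∀ s ∈ T, ∃ t, s <+: t ∧ IsSplitting T t}

/-- Measurability of a set of branches with respect to a tree forcing `P`. -/
def ForcingMeasurable {α : Type} (P : Set (tree α)) (A : Set (ℕ → α)) : Prop :=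
  ∀ p ∈ P, ∃ p' ∈ P, p' ≤ p ∧ (branches p' ∩ A = ∅ ∨ branches p' ∩ Aᶜ = ∅)

/-! ### Hechler forcing and the dominating topology -/

/-- The set `[N, f]` of all `x` that extend `f ↾ N` and are everywhere at least `f`. -/
def hechlerSet (N : ℕ) (f : ℕ → ℕ) : Set (ℕ → ℕ) :=
  {x | (∀ n < N, x n = f n) ∧ ∀ n, f n ≤ x n}

/-- The dominating topology, generated by the sets `[N, f]`. -/
abbrev dominatingTopology : TopologicalSpace (ℕ → ℕ) :=
  TopologicalSpace.generateFrom {U | ∃ N f, U = hechlerSet N f}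

/-! ### Pointclasses

Baire space is `ℕ → ℕ` and Cantor space is `ℕ → Bool`, with their product topologies. -/

/-- A pointclass: a collection of sets of reals, i.e. of subsets of Baire space and of
Cantor space. -/
structure Pointclass where
  /-- the members that are subsets of Baire space -/
  baire : Set (Set (ℕ → ℕ))
  /-- the members that are subsets of Cantor space -/
  cantor : Set (Set (ℕ → Bool))

namespace Pointclass

/-- Closure under continuous preimages (between any two of the two spaces) and under
intersections with closed sets. -/
structure TopologicallyReasonable (Γ : Pointclass) : Prop where
  preimage_baire_baire : ∀ g : (ℕ → ℕ) → (ℕ → ℕ), Continuous g →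
    ∀ A ∈ Γ.baire, g ⁻¹' A ∈ Γ.baire
  preimage_baire_cantor : ∀ g : (ℕ → ℕ) → (ℕ → Bool), Continuous g →
    ∀ A ∈ Γ.cantor, g ⁻¹' A ∈ Γ.baire
  preimage_cantor_baire : ∀ g : (ℕ → Bool) → (ℕ → ℕ), Continuous g →
    ∀ A ∈ Γ.baire, g ⁻¹' A ∈ Γ.cantor
  preimage_cantor_cantor : ∀ g : (ℕ → Bool) → (ℕ → Bool), Continuous g →
    ∀ A ∈ Γ.cantor, g ⁻¹' A ∈ Γ.cantor
  inter_closed_baire : ∀ A ∈ Γ.baire, ∀ Q : Set (ℕ → ℕ), IsClosed Q → A ∩ Q ∈ Γ.baire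
  inter_closed_cantor : ∀ A ∈ Γ.cantor, ∀ Q : Set (ℕ → Bool), IsClosed Q → A ∩ Q ∈ Γ.cantor

variable (Γ : Pointclass)

/-- `Γ(𝔻)`: every subset of Baire space in `Γ` has the Baire property in the dominating
topology. -/
def Hechler : Prop :=
  ∀ A ∈ Γ.baire, @BaireMeasurableSet (ℕ → ℕ) dominatingTopology A

/-- `Γ(ℂ)`: every subset of Baire space in `Γ` has the Baire property. -/
def Cohen : Prop :=
  ∀ A ∈ Γ.baire, BaireMeasurableSet A

/-- The variant of `Γ(ℂ)` for Cohen forcing regarded on Cantor space. -/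
def CohenCantor : Prop :=
  ∀ A ∈ Γ.cantor, BaireMeasurableSet A

/-- `Γ(𝕃)` -/
def Laver : Prop :=
  ∀ A ∈ Γ.baire, ForcingMeasurable laverForcing A

/-- `Γ(𝕄)` -/
def Miller : Prop :=
  ∀ A ∈ Γ.baire, ForcingMeasurable millerForcing A

/-- `Γ(𝕊)` -/
def Sacks : Prop :=
  ∀ A ∈ Γ.cantor, ForcingMeasurable sacksForcing A

end Pointclass

end Reals

/-! Superperfect and Laver trees are handled through schemes: maps of nodes sending distinct
successors to extensions of distinct successors. A scheme `G` induces a continuous injection `body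
G`, and all branches of the tree it generates lie in the range. Each tree contains a scheme and each
scheme of the right kind generates a tree, so measurability of `A` below a given tree reduces to
finding a scheme inside the preimage of `A`, or of its complement, under `body G`. Closure of the
pointclass under continuous preimages supplies the measurability of that preimage.

Laver to Miller is then immediate, since Laver trees are superperfect. Cohen to Miller builds a
scheme through countably many dense open sets. For Miller to Sacks, Baire space is embedded in a
perfect tree by `graphCode`; a copy of Cantor space inside the homogeneous superperfect tree has
compact image, hence yields a perfect tree.

The Hechler implications pull `A` back to the dominating topology and rest on
`exists_uniform_promise`: for countably many dense families of conditions a single function `d`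
serves as promise. Only the countably many stems then remain, so ordinary category or fusion
arguments apply, and `exists_generic` produces the point `x`. For Cohen, `x` is mapped
coordinatewise by some `c` taking every value at arbitrarily large arguments, so growth above `d`
does not restrict the image (`baireMeasurableSet_of_hechler`). For Laver, `x` labels all finite
sequences and is mapped to the path following its labels. A rank argument
(`exists_laverScheme_meeting`) gives a Laver scheme each of whose branches is the path of a generic
`x`. -/

open scoped Topology

namespace Reals

/-! ### Initial segments of infinite sequences -/

section Restriction

variable {α β γ : Type}

/-- The initial segment of length `n` of `x`. -/
def res (x : ℕ → α) (n : ℕ) : List α := (List.range n).map x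

@[simp] lemma res_length (x : ℕ → α) (n : ℕ) : (res x n).length = n := by simp [res]

@[simp] lemma res_zero (x : ℕ → α) : res x 0 = [] := rfl

lemma res_succ (x : ℕ → α) (n : ℕ) : res x (n + 1) = res x n ++ [x n] := by
  simp [res, List.range_succ]

lemma res_getD (x : ℕ → α) {n i : ℕ} (h : i < n) (a : α) : (res x n).getD i a = x i := by
  simp [res, List.getD, h]

lemma res_eq_res {x y : ℕ → α} {n : ℕ} : res x n = res y n ↔ ∀ i < n, x i = y i := by
  simp [res]

lemma res_prefix (x : ℕ → α) {m n : ℕ} (h : m ≤ n) : res x m <+: res x n := by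
  induction n, h using Nat.le_induction with
  | base => exact List.prefix_refl _
  | succ n _ ih => exact ih.trans (by rw [res_succ]; exact List.prefix_append _ _)

lemma eq_res_of_prefix {x : ℕ → α} {n : ℕ} {l : List α} (h : l <+: res x n) :
    l = res x l.length := by
  have hl : l.length ≤ n := by simpa using h.length_le
  exact (List.prefix_of_prefix_length_le h (res_prefix x hl) (by simp)).eq_of_length (by simp)

lemma exists_res_eq [Inhabited α] (l : List α) : ∃ x : ℕ → α, res x l.length = l := by
  refine ⟨fun i => l.getD i default, List.ext_getElem (by simp) fun i h _ => ?_⟩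
  have h' : i < l.length := by simpa using h
  simp [res, h']

lemma continuous_of_res [TopologicalSpace α] [DiscreteTopology α] [TopologicalSpace β]
    (f : List α → β) (n : ℕ) : Continuous fun x : ℕ → α => f (res x n) := by
  have h : (fun x : ℕ → α => f (res x n)) =
      (fun v : Fin n → α => f (List.ofFn v)) ∘ fun (x : ℕ → α) (i : Fin n) => x i := by
    funext x
    simp only [Function.comp_apply]
    congr 1
    apply List.ext_getElem <;> simp [res]
  rw [h]
  exact continuous_of_discreteTopology.comp (by fun_prop)

lemma isOpen_of_res [TopologicalSpace α] [DiscreteTopology α] {U : Set (ℕ → α)}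
    (h : ∀ x ∈ U, ∃ n, ∀ y, res y n = res x n → y ∈ U) : IsOpen U := by
  rw [isOpen_iff_mem_nhds]
  intro x hx
  obtain ⟨n, hn⟩ := h x hx
  exact Filter.mem_of_superset ((PiNat.isOpen_cylinder (fun _ : ℕ => α) x n).mem_nhds
    (PiNat.self_mem_cylinder x n)) fun y hy => hn y (res_eq_res.2 (PiNat.mem_cylinder_iff.1 hy))

lemma exists_res_of_isOpen [TopologicalSpace α] [DiscreteTopology α] {U : Set (ℕ → α)}
    (hU : IsOpen U) {x : ℕ → α} (hx : x ∈ U) : ∃ n, ∀ y, res y n = res x n → y ∈ U := by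
  obtain ⟨_, ⟨z, n, rfl⟩, hz, hzU⟩ :=
    (PiNat.isTopologicalBasis_cylinders (fun _ : ℕ => α)).exists_subset_of_mem_open hx hU
  refine ⟨n, fun y hy => hzU ?_⟩
  rw [PiNat.mem_cylinder_iff] at hz ⊢
  intro i hi
  rw [← hz i hi]
  exact res_eq_res.1 hy i hi

lemma exists_append_singleton_prefix {u v : List α} (h : u <+: v) (hne : u ≠ v) :
    ∃ a, u ++ [a] <+: v := by
  obtain ⟨w, rfl⟩ := h
  cases w with
  | nil => simp at hne
  | cons a w => exact ⟨a, w, by simp⟩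

lemma exists_split_of_incomparable {u v : List α} (h : ¬ u <+: v) (h' : ¬ v <+: u) :
    ∃ w a b, a ≠ b ∧ w ++ [a] <+: u ∧ w ++ [b] <+: v := by
  induction u generalizing v with
  | nil => exact absurd (List.nil_prefix) h
  | cons a u ih =>
    cases v with
    | nil => exact absurd (List.nil_prefix) h'
    | cons b v =>
      by_cases hab : a = b
      · subst hab
        rw [List.prefix_cons_inj] at h h'
        obtain ⟨w, c, d, hcd, hu, hv⟩ := ih h h'
        exact ⟨a :: w, c, d, hcd, by simpa using hu, by simpa using hv⟩
      · exact ⟨[], a, b, hab, by simp, by simp⟩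

end Restriction

/-! ### Schemes of finite sequences -/

section Schemes

variable {α β γ : Type}

/-- A map of nodes that sends distinct successors of a node to extensions of distinct
successors of its image. -/
def IsScheme (G : List β → List α) : Prop :=
  ∀ u, ∃ e : β → α, e.Injective ∧ ∀ b, G u ++ [e b] <+: G (u ++ [b])

/-- A scheme that sends successors to successors. -/
def IsLaverScheme (G : List β → List α) : Prop :=
  ∀ u, ∃ e : β → α, e.Injective ∧ ∀ b, G (u ++ [b]) = G u ++ [e b]

lemma IsLaverScheme.isScheme {G : List β → List α} (hG : IsLaverScheme G) : IsScheme G :=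
  fun u => (hG u).imp fun _ he => ⟨he.1, fun b => by rw [he.2 b]⟩

lemma IsLaverScheme.comp {G : List β → List α} {H : List γ → List β} (hG : IsLaverScheme G)
    (hH : IsLaverScheme H) : IsLaverScheme (G ∘ H) := by
  intro u
  obtain ⟨e, he, heu⟩ := hH u
  obtain ⟨e', he', heu'⟩ := hG (H u)
  exact ⟨e' ∘ e, he'.comp he, fun c => by simp [heu, heu']⟩

namespace IsScheme

variable {G : List β → List α} (hG : IsScheme G)
include hG

lemma mono {u v : List β} (h : u <+: v) : G u <+: G v := by
  obtain ⟨w, rfl⟩ := h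
  induction w using List.reverseRecOn with
  | nil => simp
  | append_singleton w b ih =>
    obtain ⟨e, -, he⟩ := hG (u ++ w)
    rw [← List.append_assoc]
    exact ih.trans ((List.prefix_append _ _).trans (he b))

/-- Incomparable arguments split at some node, where the scheme sends the two successors in
incompatible directions. -/
lemma comparable {u v : List β} {w : List α} (hu : G u <+: w) (hv : G v <+: w) :
    u <+: v ∨ v <+: u := by
  by_contra! h
  obtain ⟨c, a, b, hab, hca, hcb⟩ := exists_split_of_incomparable h.1 h.2
  obtain ⟨e, he, hec⟩ := hG c
  have h1 := ((hec a).trans (hG.mono hca)).trans hu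
  have h2 := ((hec b).trans (hG.mono hcb)).trans hv
  have h3 := (List.prefix_of_prefix_length_le h1 h2 (by simp)).eq_of_length (by simp)
  exact hab (he (by simpa using h3))

lemma comp {H : List γ → List β} (hH : IsScheme H) : IsScheme (G ∘ H) := by
  intro u
  obtain ⟨e, he, heu⟩ := hH u
  obtain ⟨e', he', heu'⟩ := hG (H u)
  exact ⟨e' ∘ e, he'.comp he, fun c => (heu' _).trans (hG.mono (heu c))⟩

lemma le_length_res (y : ℕ → β) (n : ℕ) : n ≤ (G (res y n)).length := by
  induction n with
  | zero => simp
  | succ n ih =>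
    obtain ⟨e, -, he⟩ := hG (res y n)
    have := (he (y n)).length_le
    rw [← res_succ] at this
    simp at this
    omega

end IsScheme

variable [Inhabited α]

/-- The map of infinite sequences induced by a map of nodes. -/
def body (G : List β → List α) (y : ℕ → β) : ℕ → α :=
  -- For a scheme, the image of a node of length `n + 1` has length above `n`, so the default is
  -- never read.
  fun n => (G (res y (n + 1))).getD n default

lemma continuous_body [TopologicalSpace α] [TopologicalSpace β]
    [DiscreteTopology β] (G : List β → List α) : Continuous (body G) :=
  continuous_pi fun n => continuous_of_res (fun l => (G l).getD n default) (n + 1)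

namespace IsScheme

variable {G : List β → List α} (hG : IsScheme G)
include hG

lemma body_eq_iff {x : ℕ → α} {y : ℕ → β} :
    body G y = x ↔ ∀ k, G (res y k) = res x (G (res y k)).length := by
  constructor
  · rintro rfl k
    refine List.ext_getElem (by simp) fun i hi _ => ?_
    have h2 : i < (G (res y (i + 1))).length := hG.le_length_res y (i + 1)
    simp only [res, body, List.getElem_map, List.getElem_range]
    change _ = (G (res y (i + 1))).getD i default
    rw [List.getD_eq_getElem _ _ h2]
    rcases le_total k (i + 1) with h | h
    · exact (hG.mono (res_prefix y h)).getElem hi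
    · exact ((hG.mono (res_prefix y h)).getElem h2).symm
  · intro h
    funext n
    rw [body, h (n + 1)]
    exact res_getD _ (hG.le_length_res y (n + 1)) _

lemma res_body (y : ℕ → β) (k : ℕ) :
    res (body G y) (G (res y k)).length = G (res y k) :=
  (hG.body_eq_iff.1 rfl k).symm

lemma body_comp [Inhabited β] {H : List γ → List β} (hH : IsScheme H) (y : ℕ → γ) :
    body (G ∘ H) y = body G (body H y) := by
  rw [(hG.comp hH).body_eq_iff]
  intro k
  simp only [Function.comp_apply]
  rw [← hH.res_body y k, hG.res_body]

lemma body_injective : Function.Injective (body G) := by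
  intro y y' h
  funext n
  have h1 := hG.res_body y (n + 1)
  have h2 := hG.res_body y' (n + 1)
  rw [h] at h1
  set x := body G y'
  set N := max (G (res y (n + 1))).length (G (res y' (n + 1))).length
  have h3 : G (res y (n + 1)) <+: res x N := h1 ▸ res_prefix x (by simp [N])
  have h4 : G (res y' (n + 1)) <+: res x N := h2 ▸ res_prefix x (by simp [N])
  have h5 : res y (n + 1) = res y' (n + 1) := by
    rcases hG.comparable h3 h4 with h | h
    · exact h.eq_of_length (by simp)
    · exact (h.eq_of_length (by simp)).symm
  exact res_eq_res.1 h5 n (by omega)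

lemma body_mem_branches {T : tree α} (hT : ∀ u, G u ∈ T) (y : ℕ → β) :
    body G y ∈ branches T := by
  intro n
  change res (body G y) n ∈ T
  refine Tree.mem_of_prefix (res_prefix _ (hG.le_length_res y n)) ?_
  rw [hG.res_body]
  exact hT _

end IsScheme

/-- The tree of initial segments of the values of a map of nodes. -/
def schemeTree (G : List β → List α) : tree α :=
  ⟨{t | ∃ u, t <+: G u}, fun _ _ ⟨u, hu⟩ => ⟨u, (List.prefix_append _ _).trans hu⟩⟩

omit [Inhabited α] in
lemma schemeTree_le {G : List β → List α} {T : tree α} (hT : ∀ u, G u ∈ T) :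
    schemeTree G ≤ T := fun _ ⟨u, hu⟩ => Tree.mem_of_prefix hu (hT u)

namespace IsScheme

variable {G : List β → List α} (hG : IsScheme G)
include hG

-- All sufficiently long initial segments of `x` pass through the same successor of `G u`, and
-- injectivity of `e` turns this into a single `b`. Thus no compactness is needed, even for infinite
-- `β`.
omit [Inhabited α] in
lemma extend_branch {x : ℕ → α} (hx : x ∈ branches (schemeTree G)) {u : List β}
    (hu : G u = res x (G u).length) :
    ∃ b, G (u ++ [b]) = res x (G (u ++ [b])).length := by
  obtain ⟨e, he, heu⟩ := hG u
  have key : ∀ n, (G u).length < n → ∃ b, e b = x (G u).length ∧ ∃ v, u ++ [b] <+: v ∧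
      res x n <+: G v := by
    intro n hn
    obtain ⟨v, hv⟩ : ∃ v, res x n <+: G v := hx n
    have huv : G u <+: G v := (hu ▸ res_prefix x hn.le : G u <+: res x n).trans hv
    have hle : n ≤ (G v).length := by simpa using hv.length_le
    have hpre : u <+: v := by
      rcases hG.comparable huv (List.prefix_refl _) with h | h
      · exact h
      · have := (hG.mono h).length_le
        omega
    have hne : u ≠ v := by rintro rfl; omega
    obtain ⟨b, hb⟩ := exists_append_singleton_prefix hpre hne
    refine ⟨b, ?_, v, hb, hv⟩
    have h1 := (heu b).trans (hG.mono hb)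
    have h2 := (res_prefix x (Nat.succ_le_of_lt hn)).trans hv
    have h3 := (List.prefix_of_prefix_length_le h1 h2 (by simp)).eq_of_length (by simp)
    rw [Nat.succ_eq_add_one, res_succ] at h3
    simpa using (List.append_inj' h3 rfl).2
  obtain ⟨b, hb, -⟩ := key _ (Nat.lt_succ_self _)
  have hlt : (G u).length < (G (u ++ [b])).length := by
    have := (heu b).length_le
    simp at this
    omega
  obtain ⟨b', hb', v, hv, hxv⟩ := key _ hlt
  obtain rfl : b' = b := he (hb'.trans hb.symm)
  exact ⟨b', (List.prefix_of_prefix_length_le (hG.mono hv) hxv (by simp)).eq_of_length (by simp)⟩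

lemma exists_body_eq {x : ℕ → α} (hx : x ∈ branches (schemeTree G)) : ∃ y, body G y = x := by
  have hstart : G [] = res x (G []).length := by
    obtain ⟨v, hv⟩ : ∃ v, res x (G []).length <+: G v := hx _
    exact (List.prefix_of_prefix_length_le (hG.mono List.nil_prefix) hv (by simp)).eq_of_length
      (by simp)
  choose f hf using fun u : {u // G u = res x (G u).length} => hG.extend_branch hx u.2
  let s : ℕ → {u // G u = res x (G u).length} :=
    fun n => Nat.rec ⟨[], hstart⟩ (fun _ u => ⟨u.1 ++ [f u], hf u⟩) n
  have hs : ∀ n, res (fun k => f (s k)) n = (s n).1 := by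
    intro n
    induction n with
    | zero => rfl
    | succ n ih => rw [res_succ, ih]
  refine ⟨fun k => f (s k), hG.body_eq_iff.2 fun k => ?_⟩
  rw [hs]
  exact (s k).2

end IsScheme

end Schemes

/-! ### Superperfect trees and Laver trees from schemes -/

/-- The splitting nodes are exactly the values of the scheme: two extensions that part at `s` come
from arguments that part at some `w`, and comparing lengths forces `s = G w`. -/
lemma IsScheme.schemeTree_mem_millerForcing {G : List ℕ → List ℕ} (hG : IsScheme G) :
    schemeTree G ∈ millerForcing := by
  have homega : ∀ u, IsOmegaSplitting (schemeTree G) (G u) := by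
    intro u
    obtain ⟨e, he, heu⟩ := hG u
    exact ⟨⟨u, List.prefix_refl _⟩, (Set.infinite_range_of_injective he).mono
      (by rintro _ ⟨b, rfl⟩; exact ⟨_, heu b⟩)⟩
  refine ⟨⟨[], List.nil_prefix⟩, ?_, ?_⟩
  · rintro s ⟨-, a, ⟨u, hu⟩, b, ⟨v, hv⟩, hab⟩
    have hnc : ∀ w, ¬ (s ++ [a] <+: w ∧ s ++ [b] <+: w) := by
      rintro w ⟨h1, h2⟩
      have := (List.prefix_of_prefix_length_le h1 h2 (by simp)).eq_of_length (by simp)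
      exact hab (by simpa using this)
    obtain ⟨w, c, d, hcd, hc, hd⟩ := exists_split_of_incomparable
      (fun h => hnc _ ⟨hu.trans (hG.mono h), hv⟩) (fun h => hnc _ ⟨hu, hv.trans (hG.mono h)⟩)
    obtain ⟨e, he, hew⟩ := hG w
    have h1 := (hew c).trans (hG.mono hc)
    have h2 := (hew d).trans (hG.mono hd)
    have hs : s = G w := by
      rcases lt_trichotomy s.length (G w).length with h | h | h
      · have h3 : s ++ [a] <+: G w := List.prefix_of_prefix_length_le hu
          ((List.prefix_append _ _).trans h1) (by simp; omega)
        have h4 : s ++ [b] <+: G w := List.prefix_of_prefix_length_le hv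
          ((List.prefix_append _ _).trans h2) (by simp; omega)
        exact absurd ⟨h3, h4⟩ (hnc _)
      · exact (List.prefix_of_prefix_length_le ((List.prefix_append _ _).trans hu)
          ((List.prefix_append _ _).trans h1) h.le).eq_of_length h
      · have h3 : G w ++ [e c] <+: s := List.prefix_of_prefix_length_le h1
          ((List.prefix_append _ _).trans hu) (by simp; omega)
        have h4 : G w ++ [e d] <+: s := List.prefix_of_prefix_length_le h2
          ((List.prefix_append _ _).trans hv) (by simp; omega)
        have := (List.prefix_of_prefix_length_le h3 h4 (by simp)).eq_of_length (by simp)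
        exact absurd (he (by simpa using this)) hcd
    rw [hs]
    exact homega w
  · rintro s ⟨u, hu⟩
    exact ⟨G u, hu, (homega u).1, (homega u).2.nontrivial⟩

lemma IsLaverScheme.schemeTree_mem_laverForcing {G : List ℕ → List ℕ} (hG : IsLaverScheme G) :
    schemeTree G ∈ laverForcing := by
  have hS := hG.isScheme
  refine ⟨G [], ⟨[], List.prefix_refl _⟩, ?_, ?_⟩
  · rintro t ⟨u, hu⟩
    exact List.prefix_or_prefix_of_prefix hu (hS.mono List.nil_prefix)
  · rintro t ⟨u, hu⟩ ht
    have : ∃ v, t = G v := by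
      induction u using List.reverseRecOn with
      | nil => exact ⟨[], hu.eq_of_length_le ht.length_le⟩
      | append_singleton u b ih =>
        obtain ⟨e, -, he⟩ := hG u
        rw [he, List.prefix_concat_iff] at hu
        rcases hu with h | h
        · exact ⟨u ++ [b], by rw [h, he]⟩
        · exact ih h
    obtain ⟨v, rfl⟩ := this
    obtain ⟨e, he, hev⟩ := hG v
    exact ⟨⟨v, List.prefix_refl _⟩, (Set.infinite_range_of_injective he).mono
      (by rintro _ ⟨b, rfl⟩; exact ⟨v ++ [b], by rw [hev]⟩)⟩

end Reals

namespace Reals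

/-! ### Schemes from state machines -/

section StateMachines

variable {α β σ : Type} {node : σ → List α} {next : σ → β → σ} {Q : Set σ} {s₀ : σ}

lemma foldl_mem (h₀ : s₀ ∈ Q) (hQ : ∀ s ∈ Q, ∀ b, next s b ∈ Q) (u : List β) :
    u.foldl next s₀ ∈ Q := by
  induction u using List.reverseRecOn with
  | nil => exact h₀
  | append_singleton u b ih => simpa using hQ _ ih b

lemma isScheme_foldl (h₀ : s₀ ∈ Q) (hQ : ∀ s ∈ Q, ∀ b, next s b ∈ Q)
    (h : ∀ s ∈ Q, ∃ e : β → α, e.Injective ∧ ∀ b, node s ++ [e b] <+: node (next s b)) :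
    IsScheme fun u : List β => node (u.foldl next s₀) := by
  intro u
  simpa using h _ (foldl_mem h₀ hQ u)

lemma isLaverScheme_foldl (h₀ : s₀ ∈ Q) (hQ : ∀ s ∈ Q, ∀ b, next s b ∈ Q)
    (h : ∀ s ∈ Q, ∃ e : β → α, e.Injective ∧ ∀ b, node (next s b) = node s ++ [e b]) :
    IsLaverScheme fun u : List β => node (u.foldl next s₀) := by
  intro u
  simpa using h _ (foldl_mem h₀ hQ u)

end StateMachines

/-! ### Schemes inside superperfect, Laver and perfect trees -/

/-- Alternate between extending to a node in `Q` and branching there through `e`. -/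
lemma exists_scheme_of_extension {α β : Type} {T : tree α} {Q : Set (List α)} (hT : [] ∈ T)
    (hext : ∀ s ∈ T, ∃ t, s <+: t ∧ t ∈ Q) (hQT : ∀ t ∈ Q, t ∈ T)
    (hQ : ∀ t ∈ Q, ∃ e : β → α, e.Injective ∧ ∀ b, t ++ [e b] ∈ T) :
    ∃ G : List β → List α, IsScheme G ∧ ∀ u, G u ∈ T := by
  choose! ext hpre hmem using hext
  have h₀ := hmem _ hT
  have : Nonempty (β → α) := ⟨(hQ _ h₀).choose⟩
  choose! e he heT using hQ
  have hnext : ∀ t ∈ Q, ∀ b, ext (t ++ [e t b]) ∈ Q := fun t ht b => hmem _ (heT t ht b)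
  exact ⟨_, isScheme_foldl (node := id) h₀ hnext
    fun t ht => ⟨e t, he t ht, fun b => hpre _ (heT t ht b)⟩,
    fun u => hQT _ (foldl_mem h₀ hnext u)⟩

lemma IsOmegaSplitting.exists_injective {T : tree ℕ} {s : List ℕ} (h : IsOmegaSplitting T s) :
    ∃ e : ℕ → ℕ, e.Injective ∧ ∀ b, s ++ [e b] ∈ T :=
  ⟨fun n => h.2.natEmbedding _ n, fun _ _ hab => (h.2.natEmbedding _).injective (Subtype.ext hab),
    fun b => (h.2.natEmbedding _ b).2⟩

lemma exists_scheme_of_mem_millerForcing {T : tree ℕ} (hT : T ∈ millerForcing) :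
    ∃ G : List ℕ → List ℕ, IsScheme G ∧ ∀ u, G u ∈ T := by
  obtain ⟨h₀, hsplit, hext⟩ := hT
  exact exists_scheme_of_extension (Q := {t | IsOmegaSplitting T t}) h₀
    (fun s hs => (hext s hs).imp fun t ht => ⟨ht.1, hsplit t ht.2⟩) (fun t ht => ht.1)
    fun t ht => ht.exists_injective

lemma exists_scheme_of_mem_sacksForcing {T : tree Bool} (hT : T ∈ sacksForcing) :
    ∃ G : List Bool → List Bool, IsScheme G ∧ ∀ u, G u ∈ T := by
  refine exists_scheme_of_extension (Q := {t | IsSplitting T t}) hT.1 hT.2 (fun t ht => ht.1) ?_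
  rintro t ⟨-, a, ha, b, hb, hab⟩
  refine ⟨fun c => if c then a else b, ?_, ?_⟩
  · intro c d h
    cases c <;> cases d <;> simp_all
  · intro c
    cases c
    · exact hb
    · exact ha

lemma exists_laverScheme_of_mem_laverForcing {T : tree ℕ} (hT : T ∈ laverForcing) :
    ∃ G : List ℕ → List ℕ, IsLaverScheme G ∧ ∀ u, G u ∈ T := by
  obtain ⟨s, hs, -, hsplit⟩ := hT
  have hQ : ∀ t ∈ {t | t ∈ T ∧ s <+: t}, ∃ e : ℕ → ℕ, e.Injective ∧ ∀ b, t ++ [e b] ∈ T :=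
    fun t ht => (hsplit t ht.1 ht.2).exists_injective
  choose! e he heT using hQ
  have h₀ : s ∈ {t | t ∈ T ∧ s <+: t} := ⟨hs, List.prefix_refl _⟩
  have hnext : ∀ t ∈ {t | t ∈ T ∧ s <+: t}, ∀ b, t ++ [e t b] ∈ {t | t ∈ T ∧ s <+: t} :=
    fun t ht b => ⟨heT t ht b, ht.2.trans (List.prefix_append _ _)⟩
  exact ⟨_, isLaverScheme_foldl (node := id) h₀ hnext fun t ht => ⟨e t, he t ht, fun b => rfl⟩,
    fun u => (foldl_mem h₀ hnext u).1⟩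

lemma laverForcing_subset_millerForcing : laverForcing ⊆ millerForcing := by
  rintro T ⟨s, hs, hcomp, hsplit⟩
  refine ⟨Tree.mem_of_prefix List.nil_prefix hs, ?_, ?_⟩
  · rintro t ⟨ht, a, ha, b, hb, hab⟩
    refine hsplit t ht ?_
    by_contra hst
    have key : ∀ c, t ++ [c] ∈ T → t ++ [c] <+: s := by
      intro c hc
      rcases hcomp _ hc with h | h
      · exact h
      · rcases List.prefix_concat_iff.1 h with h | h
        · rw [h]
        · exact absurd h hst
    have := (List.prefix_of_prefix_length_le (key a ha) (key b hb) (by simp)).eq_of_length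
      (by simp)
    exact hab (by simpa using this)
  · intro t ht
    rcases hcomp t ht with h | h
    · have := hsplit s hs (List.prefix_refl _)
      exact ⟨s, h, this.1, this.2.nontrivial⟩
    · have := hsplit t ht h
      exact ⟨t, List.prefix_refl _, this.1, this.2.nontrivial⟩

/-! ### Reduction of tree measurability to schemes -/

lemma forcingMeasurable_of_subset {α : Type} {P : Set (tree α)} {A : Set (ℕ → α)}
    (h : ∀ p ∈ P, ∃ p' ∈ P, p' ≤ p ∧ ∃ B, (B = A ∨ B = Aᶜ) ∧ branches p' ⊆ B) :
    ForcingMeasurable P A := by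
  intro p hp
  obtain ⟨p', hp', hle, B, rfl | rfl, hB⟩ := h p hp
  · exact ⟨p', hp', hle, Or.inr (Set.disjoint_iff_inter_eq_empty.1
      (Set.disjoint_compl_right_iff_subset.2 hB))⟩
  · exact ⟨p', hp', hle, Or.inl (Set.disjoint_iff_inter_eq_empty.1
      (Set.subset_compl_iff_disjoint_right.1 hB))⟩

lemma ForcingMeasurable.exists_subset {α : Type} {P : Set (tree α)} {A : Set (ℕ → α)}
    (h : ForcingMeasurable P A) {p : tree α} (hp : p ∈ P) :
    ∃ p' ∈ P, p' ≤ p ∧ ∃ B, (B = A ∨ B = Aᶜ) ∧ branches p' ⊆ B := by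
  obtain ⟨p', hp', hle, h | h⟩ := h p hp
  · exact ⟨p', hp', hle, Aᶜ, Or.inr rfl, Set.subset_compl_iff_disjoint_right.2
      (Set.disjoint_iff_inter_eq_empty.2 h)⟩
  · exact ⟨p', hp', hle, A, Or.inl rfl, Set.disjoint_compl_right_iff_subset.1
      (Set.disjoint_iff_inter_eq_empty.2 h)⟩

lemma IsScheme.branches_comp_subset {G H : List ℕ → List ℕ} (hG : IsScheme G) (hH : IsScheme H)
    {B : Set (ℕ → ℕ)} (h : ∀ y, body H y ∈ body G ⁻¹' B) : branches (schemeTree (G ∘ H)) ⊆ B := by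
  intro x hx
  obtain ⟨y, rfl⟩ := (hG.comp hH).exists_body_eq hx
  rw [hG.body_comp hH]
  exact h y

lemma forcingMeasurable_miller {A : Set (ℕ → ℕ)}
    (h : ∀ G : List ℕ → List ℕ, IsScheme G → ∃ B, (B = A ∨ B = Aᶜ) ∧
      ∃ H : List ℕ → List ℕ, IsScheme H ∧ ∀ y, body H y ∈ body G ⁻¹' B) :
    ForcingMeasurable millerForcing A := by
  refine forcingMeasurable_of_subset fun p hp => ?_
  obtain ⟨G, hG, hGp⟩ := exists_scheme_of_mem_millerForcing hp
  obtain ⟨B, hB, H, hH, hHB⟩ := h G hG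
  exact ⟨_, (hG.comp hH).schemeTree_mem_millerForcing, schemeTree_le fun u => hGp _, B, hB,
    hG.branches_comp_subset hH hHB⟩

lemma forcingMeasurable_laver {A : Set (ℕ → ℕ)}
    (h : ∀ G : List ℕ → List ℕ, IsLaverScheme G → ∃ B, (B = A ∨ B = Aᶜ) ∧
      ∃ H : List ℕ → List ℕ, IsLaverScheme H ∧ ∀ y, body H y ∈ body G ⁻¹' B) :
    ForcingMeasurable laverForcing A := by
  refine forcingMeasurable_of_subset fun p hp => ?_
  obtain ⟨G, hG, hGp⟩ := exists_laverScheme_of_mem_laverForcing hp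
  obtain ⟨B, hB, H, hH, hHB⟩ := h G hG
  exact ⟨_, (hG.comp hH).schemeTree_mem_laverForcing, schemeTree_le fun u => hGp _, B, hB,
    hG.isScheme.branches_comp_subset hH.isScheme hHB⟩

lemma preimage_eq_or_compl {X Y : Type} {g : X → Y} {A : Set Y} {B : Set X}
    (h : B = g ⁻¹' A ∨ B = (g ⁻¹' A)ᶜ) : ∃ B', (B' = A ∨ B' = Aᶜ) ∧ B = g ⁻¹' B' := by
  rcases h with rfl | rfl
  · exact ⟨A, Or.inl rfl, rfl⟩
  · exact ⟨Aᶜ, Or.inr rfl, rfl⟩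

lemma top_mem_laverForcing : (⊤ : tree ℕ) ∈ laverForcing := by
  have htop : ∀ s : List ℕ, s ∈ (⊤ : tree ℕ) := fun s => trivial
  refine ⟨[], htop _, fun t _ => Or.inr List.nil_prefix, fun t _ _ => ⟨htop _, ?_⟩⟩
  have : succs (⊤ : tree ℕ) t = Set.univ := Set.eq_univ_of_forall fun a => htop (t ++ [a])
  rw [this]
  exact Set.infinite_univ

/-! ### Laver measurability implies Miller measurability -/

namespace Pointclass

variable {Γ : Pointclass}

theorem TopologicallyReasonable.miller_of_laver (hΓ : Γ.TopologicallyReasonable)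
    (h : Γ.Laver) : Γ.Miller := by
  intro A hA
  refine forcingMeasurable_miller fun G hG => ?_
  obtain ⟨q, hq, -, B, hB, hqB⟩ := (h _ (hΓ.preimage_baire_baire _ (continuous_body G) A hA)
    ).exists_subset top_mem_laverForcing
  obtain ⟨H, hH, hHq⟩ := exists_scheme_of_mem_millerForcing (laverForcing_subset_millerForcing hq)
  obtain ⟨B', hB', rfl⟩ := preimage_eq_or_compl hB
  exact ⟨B', hB', H, hH, fun y => hqB (hH.body_mem_branches hHq y)⟩

end Pointclass

/-! ### Miller measurability implies Sacks measurability -/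

/-- The tree consists of the initial segments of points in the range. Its branches stay in the range
because a compact set is closed. -/
lemma exists_mem_sacksForcing_of_injective {k : (ℕ → Bool) → ℕ → Bool} (hk : Continuous k)
    (hinj : k.Injective) : ∃ T ∈ sacksForcing, (∀ t ∈ T, ∃ y n, t = res (k y) n) ∧
      branches T ⊆ Set.range k := by
  let T : tree Bool := ⟨{t | ∃ y n, t = res (k y) n}, by
    rintro t a ⟨y, n, h⟩
    exact ⟨y, t.length, eq_res_of_prefix (n := n) (h ▸ List.prefix_append _ _)⟩⟩
  have hT : ∀ y n, res (k y) n ∈ T := fun y n => ⟨y, n, rfl⟩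
  refine ⟨T, ⟨⟨default, 0, rfl⟩, ?_⟩, fun t ht => ht, ?_⟩
  · rintro _ ⟨y, n, rfl⟩
    have hopen : IsOpen (k ⁻¹' {x | res x n = res (k y) n}) := by
      refine IsOpen.preimage hk (isOpen_of_res fun x hx => ⟨n, fun y hy => hy.trans hx⟩)
    obtain ⟨m, hm⟩ := exists_res_of_isOpen hopen (x := y) rfl
    -- Changing `y` beyond the modulus of continuity `m` keeps the first `n` values of the image,
    -- while injectivity changes the image somewhere; the first difference is a splitting node.
    let y' := Function.update y m (!(y m))
    have hy' : res (k y') n = res (k y) n := hm y' (res_eq_res.2 fun i hi =>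
      Function.update_of_ne hi.ne _ _)
    have hne : k y' ≠ k y := fun h => by
      have := congrFun (hinj h) m
      simp [y'] at this
    have hex : ∃ l, k y' l ≠ k y l := Function.ne_iff.1 hne
    classical
    let l := Nat.find hex
    have hl : k y' l ≠ k y l := Nat.find_spec hex
    have hlt : ∀ i < l, k y' i = k y i := fun i hi => not_not.1 (Nat.find_min hex hi)
    have hnl : n ≤ l := by
      by_contra hc
      exact hl (res_eq_res.1 hy' l (by omega))
    refine ⟨res (k y) l, res_prefix _ hnl, hT _ _, k y l, ?_, k y' l, ?_, hl.symm⟩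
    · change _ ∈ T
      rw [← res_succ]
      exact hT _ _
    · change _ ∈ T
      rw [← res_eq_res.2 hlt, ← res_succ]
      exact hT _ _
  · intro x hx
    have hclosed : IsClosed (Set.range k) := (isCompact_range hk).isClosed
    rw [← hclosed.closure_eq, mem_closure_iff]
    intro U hU hxU
    obtain ⟨n, hn⟩ := exists_res_of_isOpen hU hxU
    obtain ⟨y, m, hym⟩ := hx n
    have h1 : res x n = res (k y) m := hym
    obtain rfl : n = m := by simpa using congrArg List.length h1
    exact ⟨k y, hn _ h1.symm, y, rfl⟩

/-- The characteristic function of the graph of `x`. -/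
def graphCode (x : ℕ → ℕ) : ℕ → Bool := fun n => decide (x n.unpair.1 = n.unpair.2)

lemma continuous_graphCode : Continuous graphCode :=
  continuous_pi fun n => (continuous_of_discreteTopology
    (f := fun a : ℕ => decide (a = n.unpair.2))).comp (continuous_apply n.unpair.1)

lemma graphCode_injective : Function.Injective graphCode := by
  intro x y h
  funext n
  have := congrFun h (Nat.pair n (x n))
  simp [graphCode] at this
  exact this.symm

theorem Pointclass.TopologicallyReasonable.sacks_of_miller {Γ : Pointclass}
    (hΓ : Γ.TopologicallyReasonable) (h : Γ.Miller) : Γ.Sacks := by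
  intro A hA
  refine forcingMeasurable_of_subset fun p hp => ?_
  obtain ⟨G, hG, hGp⟩ := exists_scheme_of_mem_sacksForcing hp
  have hcont : Continuous (body G ∘ graphCode) := (continuous_body G).comp continuous_graphCode
  obtain ⟨q, hq, -, B, hB, hqB⟩ := (h _ (hΓ.preimage_baire_cantor _ hcont A hA)).exists_subset
    (laverForcing_subset_millerForcing top_mem_laverForcing)
  obtain ⟨H, hH, hHq⟩ := exists_scheme_of_mem_millerForcing hq
  obtain ⟨B', hB', rfl⟩ := preimage_eq_or_compl hB
  have hι : Continuous fun (y : ℕ → Bool) n => (y n).toNat :=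
    continuous_pi fun n =>
      (continuous_of_discreteTopology (f := Bool.toNat)).comp (continuous_apply n)
  have hιinj : Function.Injective fun (y : ℕ → Bool) n => (y n).toNat := by
    intro x y hxy
    funext n
    have := congrFun hxy n
    cases hx : x n <;> cases hy : y n <;> simp_all
  obtain ⟨T, hT, hTk, hTr⟩ := exists_mem_sacksForcing_of_injective
    (hcont.comp ((continuous_body H).comp hι))
    ((hG.body_injective.comp graphCode_injective).comp (hH.body_injective.comp hιinj))
  refine ⟨T, hT, ?_, B', hB', ?_⟩
  · intro t ht
    obtain ⟨y, n, rfl⟩ := hTk t ht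
    exact hG.body_mem_branches hGp _ n
  · rintro _ hx
    obtain ⟨y, rfl⟩ := hTr hx
    exact hqB (hH.body_mem_branches hHq _)

/-! ### Cohen measurability implies Miller measurability -/

lemma exists_residual_cylinder {A : Set (ℕ → ℕ)} (hA : BaireMeasurableSet A) :
    ∃ B, (B = A ∨ B = Aᶜ) ∧ ∃ s : List ℕ,
      {x | res x s.length = s → x ∈ B} ∈ residual (ℕ → ℕ) := by
  obtain ⟨U, hU, hAU⟩ := hA.residualEq_isOpen
  rcases U.eq_empty_or_nonempty with rfl | ⟨x, hx⟩
  · refine ⟨Aᶜ, Or.inr rfl, [], ?_⟩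
    filter_upwards [hAU.mem_iff] with y hy _ hyA
    exact hy.1 hyA
  · obtain ⟨n, hn⟩ := exists_res_of_isOpen hU hx
    refine ⟨A, Or.inl rfl, res x n, ?_⟩
    filter_upwards [hAU.mem_iff] with y hy hyx
    exact hy.2 (hn y (by simpa using hyx))

lemma exists_nat_dense_of_mem_residual {X : Type} [TopologicalSpace X] {S : Set X}
    (hS : S ∈ residual X) : ∃ O : ℕ → Set X, (∀ n, IsOpen (O n)) ∧ (∀ n, Dense (O n)) ∧
      ⋂ n, O n ⊆ S := by
  obtain ⟨F, hFo, hFd, hFc, hFS⟩ := mem_residual_iff.1 hS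
  -- Adding the whole space makes the family nonempty, so that it can be enumerated.
  obtain ⟨O, hO⟩ := (hFc.insert Set.univ).exists_eq_range (Set.insert_nonempty _ _)
  have hmem : ∀ n, O n = Set.univ ∨ O n ∈ F := fun n =>
    (Set.mem_insert_iff.1 (hO ▸ Set.mem_range_self n))
  refine ⟨O, fun n => ?_, fun n => ?_, fun x hx => hFS fun t ht => ?_⟩
  · rcases hmem n with h | h
    · exact h ▸ isOpen_univ
    · exact hFo _ h
  · rcases hmem n with h | h
    · exact h ▸ dense_univ
    · exact hFd _ h
  · obtain ⟨n, rfl⟩ := (hO ▸ Set.mem_insert_of_mem _ ht : t ∈ Set.range O)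
    exact Set.mem_iInter.1 hx n

lemma exists_scheme_of_mem_residual {S : Set (ℕ → ℕ)} (s : List ℕ)
    (hS : {x | res x s.length = s → x ∈ S} ∈ residual (ℕ → ℕ)) :
    ∃ H : List ℕ → List ℕ, IsScheme H ∧ ∀ y, body H y ∈ S := by
  obtain ⟨O, hOo, hOd, hOS⟩ := exists_nat_dense_of_mem_residual hS
  have hext : ∀ (i : ℕ) (t : List ℕ), ∃ t', t <+: t' ∧ ∀ x, res x t'.length = t' → x ∈ O i := by
    intro i t
    obtain ⟨z, hz⟩ := exists_res_eq t
    have hcyl : IsOpen {x : ℕ → ℕ | res x t.length = t} :=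
      isOpen_of_res fun x hx => ⟨t.length, fun y hy => hy.trans hx⟩
    obtain ⟨x, hxt, hxO⟩ := (hOd i).inter_open_nonempty _ hcyl ⟨z, hz⟩
    obtain ⟨n, hn⟩ := exists_res_of_isOpen (hOo i) hxO
    refine ⟨res x (max n t.length), ?_, fun y hy => hn y ?_⟩
    · have hxt : res x t.length = t := hxt
      conv_lhs => rw [← hxt]
      exact res_prefix x (le_max_right _ _)
    · rw [res_length, res_eq_res] at hy
      exact res_eq_res.2 fun i hi => hy i (lt_max_of_lt_left hi)
  choose ext hpre hO using hext
  -- The counter records the level: the step leaving level `i` enters `O i`.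
  let next : List ℕ × ℕ → ℕ → List ℕ × ℕ := fun p b => (ext p.2 (p.1 ++ [b]), p.2 + 1)
  have hnext : ∀ p ∈ (Set.univ : Set (List ℕ × ℕ)), ∀ b, next p b ∈ Set.univ :=
    fun _ _ _ => trivial
  have hH : IsScheme fun u : List ℕ => (u.foldl next (s, 0)).1 :=
    isScheme_foldl (node := Prod.fst) (Set.mem_univ (s, 0)) hnext
      fun p _ => ⟨id, Function.injective_id, fun b => hpre _ _⟩
  have hlen : ∀ u : List ℕ, (u.foldl next (s, 0)).2 = u.length := by
    intro u
    induction u using List.reverseRecOn with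
    | nil => rfl
    | append_singleton u b ih => simp [next, ih]
  refine ⟨_, hH, fun y => hOS (Set.mem_iInter.2 fun i => ?_) ?_⟩
  · apply hO i (((res y i).foldl next (s, 0)).1 ++ [y i])
    have := hH.res_body y (i + 1)
    simpa [res_succ, next, hlen] using this
  · exact hH.res_body y 0

theorem Pointclass.TopologicallyReasonable.miller_of_cohen {Γ : Pointclass}
    (hΓ : Γ.TopologicallyReasonable) (h : Γ.Cohen) : Γ.Miller := by
  intro A hA
  refine forcingMeasurable_miller fun G hG => ?_
  obtain ⟨B, hB, s, hs⟩ := exists_residual_cylinder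
    (h _ (hΓ.preimage_baire_baire _ (continuous_body G) A hA))
  obtain ⟨B', hB', rfl⟩ := preimage_eq_or_compl hB
  exact ⟨B', hB', exists_scheme_of_mem_residual s hs⟩

end Reals

namespace Reals

/-! ### The dominating topology -/

/-- The set of all extensions of the finite sequence `r` that are at least `d` beyond it. -/
def hechlerBox (r : List ℕ) (d : ℕ → ℕ) : Set (ℕ → ℕ) :=
  {x | (∀ n < r.length, x n = r.getD n 0) ∧ ∀ n, r.length ≤ n → d n ≤ x n}

lemma isOpen_hechlerBox (r : List ℕ) (d : ℕ → ℕ) : IsOpen[dominatingTopology] (hechlerBox r d) := by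
  refine TopologicalSpace.GenerateOpen.basic _
    ⟨r.length, fun n => if n < r.length then r.getD n 0 else d n, ?_⟩
  ext x
  constructor
  · rintro ⟨h1, h2⟩
    refine ⟨fun n hn => by simp only [hn, if_true, h1 n hn], fun n => ?_⟩
    beta_reduce
    split_ifs with hn
    · exact (h1 n hn).ge
    · exact h2 n (not_lt.1 hn)
  · rintro ⟨h1, h2⟩
    refine ⟨fun n hn => by simpa only [hn, if_true] using h1 n hn, fun n hn => ?_⟩
    simpa only [hn.not_gt, if_false] using h2 n

lemma hechlerSet_res_subset (x : ℕ → ℕ) {N L : ℕ} (h : N ≤ L) :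
    hechlerBox (res x L) x ⊆ hechlerSet N x := by
  rintro y ⟨h1, h2⟩
  simp only [res_length] at h1 h2
  have h3 : ∀ n < L, y n = x n := fun n hn => (h1 n hn).trans (res_getD x hn 0)
  refine ⟨fun n hn => h3 n (hn.trans_le h), fun n => ?_⟩
  rcases lt_or_ge n L with hn | hn
  · exact (h3 n hn).ge
  · exact h2 n hn

lemma exists_hechlerSet_of_isOpen {U : Set (ℕ → ℕ)} (hU : IsOpen[dominatingTopology] U)
    {x : ℕ → ℕ} (hx : x ∈ U) : ∃ N, hechlerSet N x ⊆ U := by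
  induction hU with
  | basic s hs =>
    obtain ⟨N, f, rfl⟩ := hs
    exact ⟨N, fun y hy => ⟨fun n hn => (hy.1 n hn).trans (hx.1 n hn),
      fun n => (hx.2 n).trans (hy.2 n)⟩⟩
  | univ => exact ⟨0, Set.subset_univ _⟩
  | inter s t _ _ ihs iht =>
    obtain ⟨N, hN⟩ := ihs hx.1
    obtain ⟨M, hM⟩ := iht hx.2
    exact ⟨max N M, fun y hy => ⟨hN ⟨fun n hn => hy.1 n (lt_max_of_lt_left hn), hy.2⟩,
      hM ⟨fun n hn => hy.1 n (lt_max_of_lt_right hn), hy.2⟩⟩⟩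
  | sUnion S _ ih =>
    obtain ⟨t, ht, hxt⟩ := hx
    obtain ⟨N, hN⟩ := ih t ht hxt
    exact ⟨N, hN.trans (Set.subset_sUnion_of_mem ht)⟩

/-- The point can serve as its own promise: if `x` lies in `[N, f]`, then `[N, x]` is contained in
`[N, f]`. -/
lemma exists_hechlerBox_of_isOpen {U : Set (ℕ → ℕ)} (hU : IsOpen[dominatingTopology] U)
    {x : ℕ → ℕ} (hx : x ∈ U) : ∃ N, ∀ L, N ≤ L → hechlerBox (res x L) x ⊆ U :=
  (exists_hechlerSet_of_isOpen hU hx).imp fun _ hN _ hL => (hechlerSet_res_subset x hL).trans hN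

lemma hechlerBox_nonempty (r : List ℕ) (d : ℕ → ℕ) : (hechlerBox r d).Nonempty :=
  ⟨fun n => if n < r.length then r.getD n 0 else d n, fun n hn => by simp only [hn, if_true],
    fun n hn => by simp only [hn.not_gt, if_false, le_refl]⟩

lemma hechlerBox_res_subset {r : List ℕ} {d x : ℕ → ℕ} (hx : x ∈ hechlerBox r d) {L : ℕ}
    (hL : r.length ≤ L) : hechlerBox (res x L) d ⊆ hechlerBox r d := by
  rintro y ⟨h1, h2⟩
  simp only [res_length] at h1 h2
  have h3 : ∀ n < L, y n = x n := fun n hn => (h1 n hn).trans (res_getD x hn 0)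
  refine ⟨fun n hn => (h3 n (hn.trans_le hL)).trans (hx.1 n hn), fun n hn => ?_⟩
  rcases lt_or_ge n L with hnL | hnL
  · exact (hx.2 n hn).trans (h3 n hnL).ge
  · exact h2 n hnL

/-- A family of sets that is hereditary and dense for the dominating topology. -/
structure IsHechlerDense (P : Set (Set (ℕ → ℕ))) : Prop where
  hereditary : ∀ S ∈ P, ∀ S' ⊆ S, S' ∈ P
  dense : ∀ s f, ∃ t g, hechlerBox t g ⊆ hechlerBox s f ∧ hechlerBox t g ∈ P

lemma isHechlerDense_of_isOpen {O : Set (ℕ → ℕ)} (hO : IsOpen[dominatingTopology] O)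
    (hd : @Dense _ dominatingTopology O) : IsHechlerDense {S | S ⊆ O} := by
  refine ⟨fun S hS S' hS' => hS'.trans hS, fun s f => ?_⟩
  obtain ⟨x, hxs, hxO⟩ := @Dense.inter_open_nonempty _ dominatingTopology _ hd _
    (isOpen_hechlerBox s f) (hechlerBox_nonempty s f)
  obtain ⟨N, hN⟩ := exists_hechlerBox_of_isOpen
    (@IsOpen.inter _ dominatingTopology _ _ (isOpen_hechlerBox s f) hO) (x := x) ⟨hxs, hxO⟩
  exact ⟨_, _, (hN N le_rfl).trans Set.inter_subset_left, (hN N le_rfl).trans Set.inter_subset_right⟩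

lemma isHechlerDense_decide {U : Set (ℕ → ℕ)} (hU : IsOpen[dominatingTopology] U) :
    IsHechlerDense {S | S ⊆ U ∨ S ⊆ Uᶜ} := by
  refine ⟨fun S hS S' hS' => hS.imp hS'.trans hS'.trans, fun s f => ?_⟩
  by_cases h : (hechlerBox s f ∩ U).Nonempty
  · obtain ⟨x, hx⟩ := h
    obtain ⟨N, hN⟩ := exists_hechlerBox_of_isOpen
      (@IsOpen.inter _ dominatingTopology _ _ (isOpen_hechlerBox s f) hU) hx
    exact ⟨_, _, (hN N le_rfl).trans Set.inter_subset_left,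
      Or.inl ((hN N le_rfl).trans Set.inter_subset_right)⟩
  · refine ⟨s, f, subset_rfl, Or.inr ?_⟩
    exact Set.disjoint_left.mp (Set.disjoint_iff_inter_eq_empty.2 (Set.not_nonempty_iff_eq_empty.1 h))

lemma IsHechlerDense.inter {P P' : Set (Set (ℕ → ℕ))} (h : IsHechlerDense P)
    (h' : IsHechlerDense P') : IsHechlerDense (P ∩ P') := by
  refine ⟨fun S hS S' hS' => ⟨h.1 S hS.1 S' hS', h'.1 S hS.2 S' hS'⟩, fun s f => ?_⟩
  obtain ⟨t, g, hts, ht⟩ := h.2 s f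
  obtain ⟨t', g', hts', ht'⟩ := h'.2 t g
  exact ⟨t', g', hts'.trans hts, h.1 _ ht _ hts', ht'⟩

lemma exists_eventually_dominating {ι : Type} [Countable ι] (g : ι → ℕ → ℕ) (f : ℕ → ℕ) :
    ∃ d : ℕ → ℕ, f ≤ d ∧ ∀ i, ∃ L, ∀ n, L ≤ n → g i n ≤ d n := by
  obtain ⟨c, hc⟩ := exists_injective_nat ι
  classical
  let g' : ℕ → ℕ → ℕ := fun k => if h : ∃ i, c i = k then g h.choose else f
  have hg' : ∀ i, g' (c i) = g i := by
    intro i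
    have h : ∃ j, c j = c i := ⟨i, rfl⟩
    simp only [g', h, dif_pos]
    rw [hc h.choose_spec]
  refine ⟨fun n => max (f n) ((Finset.range (n + 1)).sup fun k => g' k n),
    fun n => le_max_left _ _, fun i => ⟨c i, fun n hn => ?_⟩⟩
  rw [← hg' i]
  exact le_max_of_le_right (Finset.le_sup (f := fun k => g' k n) (Finset.mem_range.2 (by omega)))

/-- One function can replace the promises in countably many dense families of conditions. -/
lemma exists_uniform_promise {P : ℕ → Set (Set (ℕ → ℕ))} (hP : ∀ i, IsHechlerDense (P i))
    (f₀ : ℕ → ℕ) : ∃ d : ℕ → ℕ, f₀ ≤ d ∧ ∀ i s f, ∃ x ∈ hechlerBox s f, ∃ L₀, ∀ L, L₀ ≤ L →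
      hechlerBox (res x L) d ∈ P i := by
  have h : ∀ p : ℕ × List ℕ, ∃ g', ∀ g, hechlerBox p.2 g ∈ P p.1 → hechlerBox p.2 g' ∈ P p.1 := by
    intro p
    by_cases h : ∃ g, hechlerBox p.2 g ∈ P p.1
    · exact h.imp fun g' hg' _ _ => hg'
    · exact ⟨0, fun g hg => absurd ⟨g, hg⟩ h⟩
  -- One promise is selected for each family and stem, whenever any promise works; there are only
  -- countably many pairs to dominate.
  choose G hG using h
  obtain ⟨d, hd₀, hd⟩ := exists_eventually_dominating G f₀
  refine ⟨d, hd₀, fun i s f => ?_⟩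
  obtain ⟨t, g, hts, ht⟩ := (hP i).dense s f
  have ht' := hG (i, t) g ht
  obtain ⟨L₁, hL₁⟩ := hd (i, t)
  -- Staying above both promises keeps `x` in the original box and in the one with the selected
  -- promise; past `L₁` the function `d` takes over.
  obtain ⟨x, hx⟩ := hechlerBox_nonempty t (fun n => max (g n) (G (i, t) n))
  have hx1 : x ∈ hechlerBox t g := ⟨hx.1, fun n hn => (le_max_left _ _).trans (hx.2 n hn)⟩
  have hx2 : x ∈ hechlerBox t (G (i, t)) := ⟨hx.1, fun n hn => (le_max_right _ _).trans (hx.2 n hn)⟩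
  refine ⟨x, hts hx1, max t.length L₁, fun L hL => (hP i).hereditary _ ht' _ ?_⟩
  refine subset_trans ?_ (hechlerBox_res_subset hx2 ((le_max_left _ _).trans hL))
  rintro y ⟨h1, h2⟩
  refine ⟨h1, fun n hn => (hL₁ n ?_).trans (h2 n hn)⟩
  simp only [res_length] at hn
  exact ((le_max_right _ _).trans hL).trans hn

/-- The `i`-th extension step from a condition `r` with the fixed promise `d`. -/
def CanExtend (d : ℕ → ℕ) (C : List ℕ → Prop) (P : Set (Set (ℕ → ℕ))) (r : List ℕ) : Prop :=
  ∃ r', C r' ∧ r.length < r'.length ∧ hechlerBox r' d ⊆ hechlerBox r d ∧ hechlerBox r' d ∈ P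

/-- A Rasiowa–Sikorski construction with fixed promise `d`. The side condition `C` keeps the stems
compatible with a prescribed image of `x`. -/
lemma exists_generic {d : ℕ → ℕ} {C : List ℕ → Prop} {P : ℕ → Set (Set (ℕ → ℕ))}
    (h : ∀ i r, C r → CanExtend d C (P i) r) {r₀ : List ℕ} (h₀ : C r₀) :
    ∃ x ∈ hechlerBox r₀ d, (∀ i, ∃ S ∈ P i, x ∈ S) ∧
      ∀ M, ∃ r, M ≤ r.length ∧ C r ∧ x ∈ hechlerBox r d := by
  choose next hC hlen hsub hP using fun i (r : {r // C r}) => h i r.1 r.2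
  let s : ℕ → {r // C r} := fun n => Nat.rec ⟨r₀, h₀⟩ (fun i r => ⟨next i r, hC i r⟩) n
  have hs : ∀ n, (s (n + 1)).1 = next n (s n) := fun n => rfl
  have hanti : Antitone fun n => hechlerBox (s n).1 d :=
    antitone_nat_of_succ_le fun n => by
      simp only [hs]
      exact hsub n (s n)
  have hle : ∀ n, n ≤ (s n).1.length := by
    intro n
    induction n with
    | zero => simp
    | succ n ih =>
      have := hlen n (s n)
      rw [hs]
      omega
  let x : ℕ → ℕ := fun n => (s (n + 1)).1.getD n 0
  have hx : ∀ k, x ∈ hechlerBox (s k).1 d := by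
    intro k
    have key : ∀ n, ∃ y ∈ hechlerBox (s k).1 d, y n = x n := by
      intro n
      obtain ⟨y, hy⟩ := hechlerBox_nonempty (s (max k (n + 1))).1 d
      exact ⟨y, hanti (le_max_left _ _) hy, (hanti (le_max_right k (n + 1)) hy).1 n (hle (n + 1))⟩
    refine ⟨fun n hn => ?_, fun n hn => ?_⟩
    · obtain ⟨y, hy, hyn⟩ := key n
      rw [← hyn, hy.1 n hn]
    · obtain ⟨y, hy, hyn⟩ := key n
      rw [← hyn]
      exact hy.2 n hn
  exact ⟨x, hx 0, fun i => ⟨_, hP i (s i), hx (i + 1)⟩, fun M => ⟨_, hle M, (s M).2, hx M⟩⟩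

/-! ### Hechler measurability implies Cohen measurability -/

section Cohen

variable {α : Type} {c : ℕ → α}

/-- The finite sequence `r` is mapped by `c` to an initial segment of `y`. -/
def CodesPrefix (c : ℕ → α) (y : ℕ → α) (r : List ℕ) : Prop :=
  ∀ m < r.length, c (r.getD m 0) = y m

/-- The density step: the `y` whose coded stem `r` can be extended into `P` contain, near any `y₀`,
a cylinder, vacuously so if `r` does not code a prefix of `y₀`. -/
lemma exists_res_mem_canExtend (hc : ∀ a m, ∃ k, m ≤ k ∧ c k = a) {d : ℕ → ℕ}
    {P : Set (Set (ℕ → ℕ))}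
    (hd : ∀ s f, ∃ x ∈ hechlerBox s f, ∃ L₀, ∀ L, L₀ ≤ L → hechlerBox (res x L) d ∈ P)
    (r : List ℕ) (y₀ : ℕ → α) (K : ℕ) : ∃ y₁, res y₁ K = res y₀ K ∧ ∃ L, ∀ y,
      res y L = res y₁ L → CodesPrefix c y r → CanExtend d (CodesPrefix c y) P r := by
  by_cases hr : CodesPrefix c y₀ r
  swap
  · refine ⟨y₀, rfl, r.length, fun y hy hyr => absurd (fun m hm => ?_) hr⟩
    rw [hyr m hm]
    exact res_eq_res.1 hy m hm
  choose v hv hcv using hc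
  -- Since `c` takes every value at arguments above `d m`, the stem continues to a preimage of `y₀`
  -- that respects the promise.
  let x₀ : ℕ → ℕ := fun m => if m < r.length then r.getD m 0 else v (y₀ m) (d m)
  have hx₀ : ∀ m, c (x₀ m) = y₀ m := by
    intro m
    by_cases hm : m < r.length
    · simp only [x₀, hm, if_true, hr m hm]
    · simp only [x₀, hm, if_false, hcv]
  have hx₀r : x₀ ∈ hechlerBox r d :=
    ⟨fun m hm => by simp only [x₀, hm, if_true], fun m hm => by
      simp only [x₀, hm.not_gt, if_false, hv]⟩
  let M := max K r.length
  obtain ⟨x, hx, L₀, hL₀⟩ := hd (res x₀ M) d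
  have hxx₀ : ∀ m < M, x m = x₀ m := fun m hm => by
    rw [hx.1 m (by simpa using hm), res_getD _ hm]
  have hxr : x ∈ hechlerBox r d := hechlerBox_res_subset hx₀r (le_max_right _ _) hx
  refine ⟨fun m => c (x m), res_eq_res.2 fun m hm => ?_, max (r.length + 1) L₀, fun y hy _ =>
    ⟨res x (max (r.length + 1) L₀), ?_, ?_, ?_, ?_⟩⟩
  · rw [hxx₀ m (lt_max_of_lt_left hm), hx₀]
  · intro m hm
    rw [res_length] at hm
    rw [res_getD _ hm]
    exact (res_eq_res.1 hy m hm).symm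
  · rw [res_length]
    exact lt_max_of_lt_left (Nat.lt_succ_self _)
  · exact hechlerBox_res_subset hxr ((Nat.le_succ _).trans (le_max_left _ _))
  · exact hL₀ _ (le_max_right _ _)

lemma baireMeasurableSet_of_hechler [TopologicalSpace α] [DiscreteTopology α]
    (hc : ∀ a m, ∃ k, m ≤ k ∧ c k = a) {A : Set (ℕ → α)}
    (hA : @BaireMeasurableSet (ℕ → ℕ) dominatingTopology ((fun x n => c (x n)) ⁻¹' A)) :
    BaireMeasurableSet A := by
  obtain ⟨U, hU, hAU⟩ := @BaireMeasurableSet.residualEq_isOpen _ dominatingTopology _ hA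
  obtain ⟨O, hOo, hOd, hO⟩ := @exists_nat_dense_of_mem_residual _ dominatingTopology _ hAU.mem_iff
  -- The second factor makes the extended stem decide `U`, which is what yields the open set `V`.
  let P : ℕ → Set (Set (ℕ → ℕ)) := fun i => {S | S ⊆ O i} ∩ {S | S ⊆ U ∨ S ⊆ Uᶜ}
  obtain ⟨d, -, hd⟩ := exists_uniform_promise (P := P)
    (fun i => (isHechlerDense_of_isOpen (hOo i) (hOd i)).inter (isHechlerDense_decide hU)) 0
  let V : Set (ℕ → α) := {y | ∃ r, CodesPrefix c y r ∧ hechlerBox r d ⊆ U}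
  have hV : IsOpen V := isOpen_of_res fun y ⟨r, hr, hrU⟩ => ⟨r.length, fun z hz =>
    ⟨r, fun m hm => (hr m hm).trans (res_eq_res.1 hz m hm).symm, hrU⟩⟩
  refine BaireMeasurableSet.iff_residualEq_isOpen.2 ⟨V, hV, ?_⟩
  have hres : ∀ p : ℕ × List ℕ, ∀ᶠ y in residual (ℕ → α),
      CodesPrefix c y p.2 → CanExtend d (CodesPrefix c y) (P p.1) p.2 := by
    intro p
    refine Filter.mem_of_superset (residual_of_dense_open isOpen_interior ?_) interior_subset
    rw [dense_iff_inter_open]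
    rintro W hW ⟨y₀, hy₀⟩
    obtain ⟨K, hK⟩ := exists_res_of_isOpen hW hy₀
    obtain ⟨y₁, hy₁, L, hL⟩ := exists_res_mem_canExtend hc (hd p.1) p.2 y₀ K
    refine ⟨y₁, hK _ hy₁, mem_interior.2 ⟨{y | res y L = res y₁ L}, fun y hy => hL y hy,
      isOpen_of_res fun x hx => ⟨L, fun y hy => hy.trans hx⟩, rfl⟩⟩
  filter_upwards [eventually_countable_forall.2 hres] with y hy
  -- Every stem compatible with `y` extends to a generic preimage `x` of `y`, so whether `y` is in
  -- `A` can be read off from `U`.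
  have hgen : ∀ r, CodesPrefix c y r → ∃ x ∈ hechlerBox r d, (x ∈ U ↔ y ∈ A) := by
    intro r hr
    obtain ⟨x, hxr, hxO, hxC⟩ := exists_generic (fun i r => hy (i, r)) hr
    have hxy : (fun n => c (x n)) = y := by
      funext n
      obtain ⟨r', hn, hr', hxr'⟩ := hxC (n + 1)
      rw [hxr'.1 n hn, hr' n hn]
    have hxA : x ∈ (fun x n => c (x n)) ⁻¹' A ↔ x ∈ U := hO (Set.mem_iInter.2 fun i => by
      obtain ⟨S, hS, hxS⟩ := hxO i
      exact hS.1 hxS)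
    rw [Set.mem_preimage, hxy] at hxA
    exact ⟨x, hxr, hxA.symm⟩
  refine propext ⟨fun hyA => ?_, ?_⟩
  · obtain ⟨r, hr, -, -, -, hrU⟩ := hy (0, []) (fun m hm => absurd hm (by simp))
    rcases hrU with h | h
    · exact ⟨r, hr, h⟩
    · obtain ⟨x, hx, hxU⟩ := hgen r hr
      exact absurd (hxU.2 hyA) (h hx)
  · rintro ⟨r, hr, hrU⟩
    obtain ⟨x, hx, hxU⟩ := hgen r hr
    exact hxU.1 (hrU hx)

end Cohen

theorem Pointclass.TopologicallyReasonable.cohen_of_hechler {Γ : Pointclass}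
    (hΓ : Γ.TopologicallyReasonable) (h : Γ.Hechler) : Γ.Cohen := by
  intro A hA
  refine baireMeasurableSet_of_hechler (c := fun k => k.unpair.1)
    (fun a m => ⟨Nat.pair a m, Nat.right_le_pair _ _, by simp⟩)
    (h _ (hΓ.preimage_baire_baire _ ?_ A hA))
  exact continuous_pi fun n => (continuous_of_discreteTopology
    (f := fun k : ℕ => k.unpair.1)).comp (continuous_apply n)

theorem Pointclass.TopologicallyReasonable.cohenCantor_of_hechler {Γ : Pointclass}
    (hΓ : Γ.TopologicallyReasonable) (h : Γ.Hechler) : Γ.CohenCantor := by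
  intro A hA
  refine baireMeasurableSet_of_hechler (c := Nat.bodd) (fun a m => ?_)
    (h _ (hΓ.preimage_baire_cantor _ ?_ A hA))
  · refine ⟨Nat.bit a m, ?_, Nat.bodd_bit a m⟩
    rw [Nat.bit_val]
    omega
  · exact continuous_pi fun n => (continuous_of_discreteTopology
      (f := Nat.bodd)).comp (continuous_apply n)

end Reals

namespace Reals

/-! ### Coding nodes by natural numbers and following a labelled path -/

/-- The code of a finite sequence. -/
def nodeCode (u : List ℕ) : ℕ := Encodable.encode u

/-- Codes grow along paths, so a path meets its labels in increasing order and a finite labelling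
determines an initial segment of it. -/
lemma nodeCode_lt_append (u : List ℕ) (a : ℕ) : nodeCode u < nodeCode (u ++ [a]) := by
  induction u with
  | nil => simp [nodeCode]
  | cons b u ih =>
    simp only [nodeCode, List.cons_append, Encodable.encode_list_cons] at ih ⊢
    exact Nat.succ_lt_succ (Nat.pair_lt_pair_right _ ih)

lemma strictMono_nodeCode_res (z : ℕ → ℕ) : StrictMono fun n => nodeCode (res z n) :=
  strictMono_nat_of_lt_succ fun n => by
    rw [res_succ]
    exact nodeCode_lt_append _ _

lemma le_nodeCode_res (z : ℕ → ℕ) (n : ℕ) : n ≤ nodeCode (res z n) :=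
  (strictMono_nodeCode_res z).le_apply

/-- The node of length `n` reached by reading `x` as a labelling of the nodes and moving from
each node to the successor given by its label. -/
def pathNode (x : ℕ → ℕ) : ℕ → List ℕ
  | 0 => []
  | n + 1 => pathNode x n ++ [x (nodeCode (pathNode x n))]

/-- The infinite path obtained by reading `x` as a labelling of the nodes and moving from each
node to the successor given by its label. -/
def labelPath (x : ℕ → ℕ) (n : ℕ) : ℕ := x (nodeCode (pathNode x n))

lemma res_labelPath (x : ℕ → ℕ) (n : ℕ) : res (labelPath x) n = pathNode x n := by
  induction n with
  | zero => rfl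
  | succ n ih => rw [res_succ, ih]; rfl

lemma labelPath_apply (x : ℕ → ℕ) (n : ℕ) :
    labelPath x n = x (nodeCode (res (labelPath x) n)) := by
  rw [res_labelPath]; rfl

lemma res_labelPath_eq {x z : ℕ → ℕ} {K : ℕ} (h : ∀ n < K, x (nodeCode (res z n)) = z n) :
    ∀ n ≤ K, res (labelPath x) n = res z n := by
  intro n
  induction n with
  | zero => simp
  | succ n ih =>
    intro hn
    rw [res_succ, res_succ, labelPath_apply, ih (by omega), h n hn]

lemma continuous_labelPath : Continuous labelPath := by
  refine continuous_pi fun n => continuous_def.2 fun V _ => isOpen_of_res fun x hx => ?_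
  refine ⟨nodeCode (res (labelPath x) n) + 1, fun y hy => ?_⟩
  have hyx : ∀ k ≤ n, y (nodeCode (res (labelPath x) k)) = labelPath x k := by
    intro k hk
    rw [labelPath_apply x k]
    exact res_eq_res.1 hy _ (Nat.lt_succ_of_le ((strictMono_nodeCode_res _).monotone hk))
  have := res_eq_res.1 (res_labelPath_eq (x := y) (z := labelPath x) (K := n + 1)
    (fun k hk => hyx k (by omega)) (n + 1) le_rfl) n (by omega)
  rwa [Set.mem_preimage, this]

/-! ### Ranks and fusion of Laver schemes -/

/-- `v` is a successor of `u` by a number at least `f u`. -/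
def StepAbove (f : List ℕ → ℕ) (u v : List ℕ) : Prop := ∃ n, f u ≤ n ∧ v = u ++ [n]

/-- `B` can be reached from every node along large successors. -/
def IsLargeDense (B : Set (List ℕ)) : Prop :=
  ∀ u f, ∃ v ∈ B, Relation.ReflTransGen (StepAbove f) u v

/-- The rank of `u` for reaching `B` along infinitely many successors is at most `α`. -/
inductive RankLE (B : Set (List ℕ)) : Ordinal.{0} → List ℕ → Prop
  | mem {α : Ordinal.{0}} {u : List ℕ} : u ∈ B → RankLE B α u
  | step {α : Ordinal.{0}} {u : List ℕ} (S : Set ℕ) (b : ℕ → Ordinal.{0}) : S.Infinite →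
      (∀ n ∈ S, b n < α) → (∀ n ∈ S, RankLE B (b n) (u ++ [n])) → RankLE B α u

/-- An unranked node has only finitely many ranked successors. A function `f` exceeding these keeps
every path above it unranked, so it never reaches `B`. -/
lemma IsLargeDense.exists_rankLE {B : Set (List ℕ)} (hB : IsLargeDense B) (u : List ℕ) :
    ∃ α, RankLE B α u := by
  have hstep : ∀ u, (¬ ∃ α, RankLE B α u) → ∃ m, ∀ n, m ≤ n → ¬ ∃ α, RankLE B α (u ++ [n]) := by
    intro u hu
    by_contra! h
    have hinf : {n | ∃ α, RankLE B α (u ++ [n])}.Infinite :=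
      Set.infinite_of_forall_exists_gt fun m => by
        obtain ⟨n, hmn, hn⟩ := h (m + 1)
        exact ⟨n, hn, hmn⟩
    have hch : ∀ n, ∃ α, (∃ α, RankLE B α (u ++ [n])) → RankLE B α (u ++ [n]) := by
      intro n
      by_cases hn : ∃ α, RankLE B α (u ++ [n])
      · exact hn.imp fun α hα _ => hα
      · exact ⟨0, fun h => absurd h hn⟩
    choose b hb using hch
    refine hu ⟨Order.succ (⨆ n, b n), .step _ b hinf (fun n _ => ?_) fun n hn => hb n hn⟩
    exact Order.lt_succ_of_le (Ordinal.le_iSup b n)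
  by_contra hu
  choose! f hf using hstep
  obtain ⟨v, hv, huv⟩ := hB u f
  have hbad : ¬ ∃ α, RankLE B α v := by
    clear hv
    induction huv with
    | refl => exact hu
    | tail _ hvw ih =>
      obtain ⟨n, hn, rfl⟩ := hvw
      exact hf _ ih n hn
  exact hbad ⟨0, .mem hv⟩

lemma IsLargeDense.exists_rank {B : Set (List ℕ)} (hB : IsLargeDense B) :
    ∃ rk : List ℕ → Ordinal.{0}, ∀ u ∉ B, {n | rk (u ++ [n]) < rk u}.Infinite := by
  refine ⟨fun u => sInf {α | RankLE B α u}, fun u hu => ?_⟩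
  have h : RankLE B (sInf {α | RankLE B α u}) u := csInf_mem (hB.exists_rankLE u)
  cases h with
  | mem h => exact absurd h hu
  | step S b hS hb hr => exact hS.mono fun n hn => 
      (csInf_le' (s := {α | RankLE B α (u ++ [n])}) (hr n hn)).trans_lt (hb n hn)

/-- Each step moves to successors of smaller rank for the current target. Well-foundedness forces
every branch to reach the target, after which the next one is pursued. -/
lemma exists_laverScheme_meeting {B : ℕ → Set (List ℕ)} (hB : ∀ k, IsLargeDense (B k))
    (u₀ : List ℕ) (f : List ℕ → ℕ) : ∃ H : List ℕ → List ℕ, IsLaverScheme H ∧ ∀ y,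
      res (body H y) u₀.length = u₀ ∧
      (∀ n, u₀.length ≤ n → f (res (body H y) n) ≤ body H y n) ∧
      ∀ k, ∃ n, res (body H y) n ∈ B k := by
  classical
  choose rk hrk using fun k => (hB k).exists_rank
  have hsucc : ∀ (u : List ℕ) (k : ℕ), ∃ e : ℕ → ℕ, e.Injective ∧ ∀ b, f u ≤ e b ∧
      (u ∉ B k → rk k (u ++ [e b]) < rk k u) := by
    intro u k
    have hinf : {n | u ∉ B k → rk k (u ++ [n]) < rk k u}.Infinite := by
      by_cases hu : u ∈ B k
      · simpa [hu] using Set.infinite_univ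
      · simpa [hu] using hrk k u hu
    have hinf' := hinf.sdiff (Set.finite_lt_nat (f u))
    refine ⟨fun b => hinf'.natEmbedding _ b,
      fun a b hab => (hinf'.natEmbedding _).injective (Subtype.ext hab), fun b => ?_⟩
    have := (hinf'.natEmbedding _ b).2
    exact ⟨not_lt.1 this.2, this.1⟩
  choose e he hef her using hsucc
  let stage : List ℕ × ℕ → ℕ := fun p => if p.1 ∈ B p.2 then p.2 + 1 else p.2
  let next : List ℕ × ℕ → ℕ → List ℕ × ℕ := fun p b => (p.1 ++ [e p.1 (stage p) b], stage p)
  have hH : IsLaverScheme fun u : List ℕ => (u.foldl next (u₀, 0)).1 :=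
    isLaverScheme_foldl (node := Prod.fst) (Set.mem_univ (u₀, 0)) (fun _ _ _ => trivial)
      fun p _ => ⟨e p.1 (stage p), he _ _, fun b => rfl⟩
  refine ⟨_, hH, fun y => ?_⟩
  set H : List ℕ → List ℕ := fun u => (u.foldl next (u₀, 0)).1
  let s : ℕ → List ℕ × ℕ := fun j => (res y j).foldl next (u₀, 0)
  have hs : ∀ j, s (j + 1) = next (s j) (y j) := fun j => by simp [s, res_succ]
  have hlen : ∀ j, (s j).1.length = u₀.length + j := by
    intro j
    induction j with
    | zero => rfl
    | succ j ih => rw [hs]; simp [next, ih]; omega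
  have hres : ∀ j, res (body H y) (u₀.length + j) = (s j).1 := fun j => by
    rw [← hlen]
    exact hH.isScheme.res_body y j
  refine ⟨hres 0, fun n hn => ?_, ?_⟩
  · obtain ⟨j, rfl⟩ := Nat.exists_eq_add_of_le hn
    have h1 := hres (j + 1)
    rw [← Nat.add_assoc, res_succ, hres j, hs] at h1
    have h2 : body H y (u₀.length + j) = e (s j).1 (stage (s j)) (y j) := by
      simpa [next] using h1
    rw [hres, h2]
    exact hef _ _ _
  · have key : ∀ k, (∃ j, (s j).2 = k) → ∃ j, (s j).2 = k ∧ (s j).1 ∈ B k := by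
      rintro k ⟨j, hj⟩
      by_contra! h
      have hconst : ∀ i, (s (j + i)).2 = k := by
        intro i
        induction i with
        | zero => exact hj
        | succ i ih =>
          have := h _ ih
          rw [← Nat.add_assoc, hs]
          simp [next, stage, ih, this]
      obtain ⟨i, hi⟩ := WellFounded.not_rel_apply_succ (r := (· < ·))
        fun i => rk k (s (j + i)).1
      refine hi ?_
      have hnot := h _ (hconst i)
      have hst : stage (s (j + i)) = k := by simp [stage, hconst i, hnot]
      rw [← Nat.add_assoc, hs]
      simp only [next, hst]
      exact her _ _ _ hnot
    have hall : ∀ k, ∃ j, (s j).2 = k := by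
      intro k
      induction k with
      | zero => exact ⟨0, rfl⟩
      | succ k ih =>
        obtain ⟨j, hj, hjB⟩ := key k ih
        refine ⟨j + 1, ?_⟩
        rw [hs]
        simp [next, stage, hj, hjB]
    intro k
    obtain ⟨j, -, hj⟩ := key k (hall k)
    exact ⟨_, by rw [hres j]; exact hj⟩

/-! ### Hechler measurability implies Laver measurability -/

/-- The finite sequence `r`, read as a partial labelling of the nodes, follows `z`. -/
def FollowsPath (z : ℕ → ℕ) (r : List ℕ) : Prop :=
  ∀ n, nodeCode (res z n) < r.length → r.getD (nodeCode (res z n)) 0 = z n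

/-- The nodes all of whose branches allow `r` to be extended into `P`. -/
def extensionNodes (d : ℕ → ℕ) (P : Set (Set (ℕ → ℕ))) (r : List ℕ) : Set (List ℕ) :=
  {u | ∀ z, res z u.length = u → FollowsPath z r →
    (∀ n, r.length ≤ nodeCode (res z n) → d (nodeCode (res z n)) ≤ z n) →
    CanExtend d (FollowsPath z) P r}

lemma exists_long_stepAbove (f : List ℕ → ℕ) (u : List ℕ) (k : ℕ) :
    ∃ v, Relation.ReflTransGen (StepAbove f) u v ∧ k ≤ v.length := by
  induction k with
  | zero => exact ⟨u, .refl, Nat.zero_le _⟩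
  | succ k ih =>
    obtain ⟨v, hv, hk⟩ := ih
    exact ⟨v ++ [f v], hv.tail ⟨f v, le_rfl, rfl⟩, by simpa using hk⟩

/-- A labelling `x` taken from the dense family above both `d` and `f` has a path that is large for
`f`; a long enough node of this path forces an initial segment of `x` to be a legitimate extension
of `r`. -/
lemma isLargeDense_extensionNodes {d : ℕ → ℕ} {P : Set (Set (ℕ → ℕ))}
    (hd : ∀ s f, ∃ x ∈ hechlerBox s f, ∃ L₀, ∀ L, L₀ ≤ L → hechlerBox (res x L) d ∈ P)
    (r : List ℕ) : IsLargeDense (extensionNodes d P r) := by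
  classical
  intro u f
  obtain ⟨u₁, huu₁, hru₁⟩ := exists_long_stepAbove f u r.length
  obtain ⟨z₁, hz₁⟩ := exists_res_eq u₁
  set K := u₁.length
  have hagree : ∀ {z}, res z K = u₁ → ∀ n < K, z n = z₁ n ∧ res z n = res z₁ n := by
    intro z hz n hn
    have h := res_eq_res.1 (hz.trans hz₁.symm)
    exact ⟨h n hn, res_eq_res.2 fun i hi => h i (hi.trans hn)⟩
  by_cases hcon : ∀ n < K, nodeCode (res z₁ n) < r.length →
      r.getD (nodeCode (res z₁ n)) 0 = z₁ n
  swap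
  · refine ⟨u₁, fun z hz hzr _ => absurd (fun n hn => ?_) hcon, huu₁⟩
    rw [← (hagree hz n hn).1, ← (hagree hz n hn).2]
    exact hzr n
  by_cases hleg : ∀ n < K, r.length ≤ nodeCode (res z₁ n) → d (nodeCode (res z₁ n)) ≤ z₁ n
  swap
  · refine ⟨u₁, fun z hz _ hzd => absurd (fun n hn => ?_) hleg, huu₁⟩
    rw [← (hagree hz n hn).1, ← (hagree hz n hn).2]
    exact hzd n
  -- Labels with code below `M` include those of all proper initial segments of `u₁`. The label of
  -- `u₁` itself is still free and will lie above `F`.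
  let M := nodeCode u₁
  have hM : nodeCode (res z₁ K) = M := by rw [hz₁]
  have hKM : K ≤ M := hM ▸ le_nodeCode_res z₁ K
  let F : ℕ → ℕ := fun m => max (d m) (f ((Encodable.decode m).getD []))
  have hF : ∀ v, f v ≤ F (nodeCode v) := fun v => by simp [F, nodeCode]
  let x₀ : ℕ → ℕ := fun m => if m < r.length then r.getD m 0 else
    if h : ∃ n < K, nodeCode (res z₁ n) = m then z₁ h.choose else d m
  have hx₀r : x₀ ∈ hechlerBox r d := by
    refine ⟨fun m hm => by simp only [x₀, hm, if_true], fun m hm => ?_⟩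
    simp only [x₀, hm.not_gt, if_false]
    split_ifs with h
    · obtain ⟨h1, h2⟩ := h.choose_spec
      have := hleg _ h1 (h2.symm ▸ hm)
      rwa [h2] at this
    · exact le_rfl
  have hx₀z : ∀ n < K, x₀ (nodeCode (res z₁ n)) = z₁ n := by
    intro n hn
    by_cases hm : nodeCode (res z₁ n) < r.length
    · simp only [x₀, hm, if_true, hcon n hn hm]
    · have h : ∃ n' < K, nodeCode (res z₁ n') = nodeCode (res z₁ n) := ⟨n, hn, rfl⟩
      simp only [x₀, hm, if_false, h, dif_pos]
      rw [(strictMono_nodeCode_res z₁).injective h.choose_spec.2]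
  obtain ⟨x, hx, L₀, hL₀⟩ := hd (res x₀ M) F
  have hxd : x ∈ hechlerBox (res x₀ M) d :=
    ⟨hx.1, fun n hn => (le_max_left _ _).trans (hx.2 n hn)⟩
  have hxr : x ∈ hechlerBox r d := hechlerBox_res_subset hx₀r (hru₁.trans hKM) hxd
  have hxz : ∀ n < K, x (nodeCode (res z₁ n)) = z₁ n := by
    intro n hn
    have hlt : nodeCode (res z₁ n) < M := hM ▸ strictMono_nodeCode_res z₁ hn
    rw [hx.1 _ (by simpa using hlt), res_getD _ hlt, hx₀z n hn]
  set z := labelPath x with hz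
  have hzK : res z K = u₁ := (res_labelPath_eq hxz K le_rfl).trans hz₁
  have hpath : ∀ n, K ≤ n → Relation.ReflTransGen (StepAbove f) u (res z n) := by
    intro n hn
    induction n, hn using Nat.le_induction with
    | base => rwa [hzK]
    | succ n hn ih =>
      refine ih.tail ⟨z n, ?_, res_succ z n⟩
      have hMn : M ≤ nodeCode (res z n) := by
        have := (strictMono_nodeCode_res z).monotone hn
        rwa [hzK] at this
      rw [hz, labelPath_apply, ← hz]
      exact (hF _).trans (hx.2 _ (by simpa using hMn))
  let L := max (r.length + 1) L₀
  refine ⟨res z (max K L), fun w hw _ _ => ⟨res x L, ?_, ?_, ?_, ?_⟩, hpath _ (le_max_left _ _)⟩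
  · intro n hn
    rw [res_length] at hn hw
    have hwz := res_eq_res.1 hw
    -- A node is no longer than its code, so nodes of `w` labelled by `res x L` lie where `w` agrees
    -- with `z`.
    have hnL : n < max K L := by
      have := le_nodeCode_res w n
      exact lt_max_of_lt_right (this.trans_lt hn)
    rw [res_getD _ hn, res_eq_res.2 fun i hi => hwz i (hi.trans hnL), hwz n hnL, hz,
      labelPath_apply x n]
  · rw [res_length]
    exact lt_max_of_lt_left (Nat.lt_succ_self _)
  · exact hechlerBox_res_subset hxr ((Nat.le_succ _).trans (le_max_left _ _))
  · exact hL₀ _ (le_max_right _ _)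

lemma exists_residual_hechlerSet {A : Set (ℕ → ℕ)} {g : (ℕ → ℕ) → ℕ → ℕ}
    (hA : @BaireMeasurableSet (ℕ → ℕ) dominatingTopology (g ⁻¹' A)) :
    ∃ B, (B = A ∨ B = Aᶜ) ∧ ∃ N f, {x | x ∈ hechlerSet N f → g x ∈ B} ∈
      @residual (ℕ → ℕ) dominatingTopology := by
  obtain ⟨U, hU, hAU⟩ := @BaireMeasurableSet.residualEq_isOpen _ dominatingTopology _ hA
  rcases U.eq_empty_or_nonempty with rfl | ⟨x, hx⟩
  · refine ⟨Aᶜ, Or.inr rfl, 0, 0, ?_⟩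
    filter_upwards [hAU.mem_iff] with y hy _ hyA
    exact hy.1 hyA
  · obtain ⟨N, hN⟩ := exists_hechlerSet_of_isOpen hU hx
    refine ⟨A, Or.inl rfl, N, x, ?_⟩
    filter_upwards [hAU.mem_iff] with y hy hyx
    exact hy.2 (hN hyx)

lemma exists_laverScheme_of_residual {B : Set (ℕ → ℕ)} {N : ℕ} {f₀ : ℕ → ℕ}
    (hB : {x | x ∈ hechlerSet N f₀ → labelPath x ∈ B} ∈ @residual (ℕ → ℕ) dominatingTopology) :
    ∃ H : List ℕ → List ℕ, IsLaverScheme H ∧ ∀ y, body H y ∈ B := by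
  obtain ⟨O, hOo, hOd, hO⟩ := @exists_nat_dense_of_mem_residual _ dominatingTopology _ hB
  obtain ⟨d, hfd, hd⟩ := exists_uniform_promise
    (fun i => isHechlerDense_of_isOpen (hOo i) (hOd i)) f₀
  obtain ⟨q, hq⟩ := exists_surjective_nat (ℕ × List ℕ)
  obtain ⟨H, hH, hHy⟩ := exists_laverScheme_meeting
    (fun k => isLargeDense_extensionNodes (hd (q k).1) (q k).2) (res (labelPath f₀) N)
    fun v => d (nodeCode v)
  refine ⟨H, hH, fun y => ?_⟩
  obtain ⟨hstem, hlarge, hmeet⟩ := hHy y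
  set z := body H y
  rw [res_length] at hstem hlarge
  -- From this code on, labels along `z` belong to nodes past the stem, where the scheme keeps `z`
  -- above `d`. Stems are therefore required to have length at least `N₀`.
  let N₀ := nodeCode (res z N)
  have hN₀ : ∀ n, N₀ ≤ nodeCode (res z n) → N ≤ n := fun n hn =>
    (strictMono_nodeCode_res z).le_iff_le.1 hn
  have hext : ∀ i r, (FollowsPath z r ∧ N₀ ≤ r.length) →
      CanExtend d (fun r => FollowsPath z r ∧ N₀ ≤ r.length) {S | S ⊆ O i} r := by
    rintro i r ⟨hr, hrN⟩
    obtain ⟨k, hk⟩ := hq (i, r)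
    obtain ⟨n, hn⟩ := hmeet k
    rw [hk] at hn
    obtain ⟨r', h1, h2, h3⟩ := hn z (by rw [res_length]) hr fun m hm =>
      hlarge m (hN₀ m (hrN.trans hm))
    exact ⟨r', ⟨h1, hrN.trans h2.le⟩, h2, h3⟩
  -- Nodes of `z` with code below `N₀` lie in the stem, which was chosen along the path of `f₀`. As
  -- `N ≤ N₀` and `f₀ ≤ d`, this start also puts `x` in `hechlerSet N f₀`.
  have h₀ : FollowsPath z (res f₀ N₀) ∧ N₀ ≤ (res f₀ N₀).length := by
    refine ⟨fun n hn => ?_, (res_length _ _).ge⟩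
    rw [res_length] at hn
    have hnN : n < N := (strictMono_nodeCode_res z).lt_iff_lt.1 hn
    have hzf := res_eq_res.1 hstem
    rw [res_getD _ hn, res_eq_res.2 fun i hi => hzf i (hi.trans hnN), hzf n hnN,
      labelPath_apply f₀ n]
  obtain ⟨x, hx, hxO, hxC⟩ := exists_generic hext h₀
  have hxz : labelPath x = z := by
    have hlab : ∀ n, x (nodeCode (res z n)) = z n := by
      intro n
      obtain ⟨r, hn, hr, hxr⟩ := hxC (nodeCode (res z n) + 1)
      rw [hxr.1 _ hn, hr.1 n hn]
    funext n
    exact res_eq_res.1 (res_labelPath_eq (K := n + 1) (fun k _ => hlab k) _ le_rfl) n (by omega)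
  have hxN : x ∈ hechlerSet N f₀ := by
    have hlt : ∀ n < N₀, x n = f₀ n := fun n hn => by
      rw [hx.1 n (by simpa using hn), res_getD _ hn]
    refine ⟨fun n hn => hlt n (hn.trans_le (le_nodeCode_res z N)), fun n => ?_⟩
    rcases lt_or_ge n N₀ with hn | hn
    · exact (hlt n hn).ge
    · exact (hfd n).trans (hx.2 n (by simpa using hn))
  rw [← hxz]
  refine hO (Set.mem_iInter.2 fun i => ?_) hxN
  obtain ⟨S, hS, hxS⟩ := hxO i
  exact hS hxS

theorem Pointclass.TopologicallyReasonable.laver_of_hechler {Γ : Pointclass}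
    (hΓ : Γ.TopologicallyReasonable) (h : Γ.Hechler) : Γ.Laver := by
  intro A hA
  refine forcingMeasurable_laver fun G hG => ?_
  obtain ⟨B, hB, N, f, hf⟩ := exists_residual_hechlerSet (h _ (hΓ.preimage_baire_baire _
    continuous_labelPath _ (hΓ.preimage_baire_baire _ (continuous_body G) A hA)))
  obtain ⟨B', hB', rfl⟩ := preimage_eq_or_compl hB
  exact ⟨B', hB', exists_laverScheme_of_residual hf⟩

end Reals

theorem mainTheorem8 (Γ : Reals.Pointclass) (hΓ : Γ.TopologicallyReasonable) :
    (Γ.Hechler → Γ.Cohen) ∧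
    (Γ.Hechler → Γ.CohenCantor) ∧
    (Γ.Hechler → Γ.Laver) ∧
    (Γ.Cohen → Γ.Miller) ∧
    (Γ.Laver → Γ.Miller) ∧
    (Γ.Miller → Γ.Sacks) :=
  ⟨hΓ.cohen_of_hechler, hΓ.cohenCantor_of_hechler, hΓ.laver_of_hechler, hΓ.miller_of_cohen,
    hΓ.miller_of_laver, hΓ.sacks_of_miller⟩
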